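/- An ordered bipartite graph $(G;A,B)$ is a finite simple bipartite graph with designated parts $A$ and $B$, each equipped with a linear order. A graph $H$ is an interval minor of $G$ if a graph isomorphic to $H$ (by a graph isomorphism preserving both linear orders and the two parts, possibly exchanging them) can be obtained from $G$ by repeatedly deleting edges and identifying two consecutive vertices of one part (the new vertex is adjacent to all the neighbours of either); otherwise $G$ is $H$-interval minor free. Two ordered bipartite graphs are equivalent if one is obtained from the other by reversing the orders in none, one or both of the parts and possibly exchanging the two parts. A matching of size $n$ is a $1$-regular ordered bipartite graph on $2n$ vertices. Its parts both have $n$ vertices, which we write as $A=\{a_1<\dots<a_n\}$ and $B=\{b_1<\dots<b_n\}$; two matchings are regarded as the same if and only if they have the same edges $a_ib_j$ (so a matching and the one obtained from it by exchanging the two parts count as different unless they coincide in this sense). **Corollary.** For every integer $n\ge 4$ there are exactly eight $K_{2,2}$-interval minor free matchings of size $n$. They form exactly three equivalence classes; that is, these eight matchings represent three equivalence classes, and every graph equivalent to one of them is again one of them. -/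

import Mathlib

/-- An ordered bipartite graph `(G; A, B)`. Its two parts are finite linearly ordered sets, which are
listed in increasing order: `A = {a_0 < a_1 < ... }` is `Fin left` and `B = {b_0 < b_1 < ... }` is
`Fin right`. All edges run between the two parts, and `Adj i j` says that `a_i b_j` is an edge. -/
@[ext]
structure OrderedBipartiteGraph where
  /-- the number of vertices of the part `A` -/
  left : ℕ
  /-- the number of vertices of the part `B` -/
  right : ℕ
  /-- adjacency between a vertex of `A` and a vertex of `B` -/
  Adj : Fin left → Fin right → Prop

namespace OrderedBipartiteGraph

/-- The complete bipartite graph `K_{r,s}`. -/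
def complete (r s : ℕ) : OrderedBipartiteGraph := ⟨r, s, fun _ _ => True⟩

/-- Exchange the two parts. -/
def swap (G : OrderedBipartiteGraph) : OrderedBipartiteGraph :=
  ⟨G.right, G.left, fun b a => G.Adj a b⟩

/-- Reverse the linear order of the part `A`. -/
def reverseLeft (G : OrderedBipartiteGraph) : OrderedBipartiteGraph :=
  ⟨G.left, G.right, fun a b => G.Adj a.rev b⟩

/-- Reverse the linear order of the part `B`. -/
def reverseRight (G : OrderedBipartiteGraph) : OrderedBipartiteGraph :=
  ⟨G.left, G.right, fun a b => G.Adj a b.rev⟩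

/-- Isomorphism of ordered bipartite graphs: a graph isomorphism that preserves the two parts,
possibly exchanging them, and preserves both linear orders. -/
def Isomorphic (G G' : OrderedBipartiteGraph) : Prop :=
  (∃ (f : Fin G.left ≃o Fin G'.left) (g : Fin G.right ≃o Fin G'.right),
      ∀ a b, G.Adj a b ↔ G'.Adj (f a) (g b)) ∨
  (∃ (f : Fin G.left ≃o Fin G'.right) (g : Fin G.right ≃o Fin G'.left),
      ∀ a b, G.Adj a b ↔ G'.Adj (g b) (f a))

/-- Delete the edge `a b`. -/
def deleteEdge (G : OrderedBipartiteGraph) (a : Fin G.left) (b : Fin G.right) :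
    OrderedBipartiteGraph :=
  ⟨G.left, G.right, fun x y => G.Adj x y ∧ ¬ (x = a ∧ y = b)⟩

/-- Identify the consecutive vertices `a_i` and `a_{i+1}` of the part `A`. The map `i.predAbove`
from `Fin (p + 1)` to `Fin p` is the monotone surjection that takes the same value at `i` and
`i + 1` and is injective otherwise. The new neighbourhood is the union of the two old ones. -/
def identifyLeft {p q : ℕ} (E : Fin (p + 1) → Fin q → Prop) (i : Fin p) :
    OrderedBipartiteGraph :=
  ⟨p, q, fun x y => ∃ x', i.predAbove x' = x ∧ E x' y⟩

/-- Identify the consecutive vertices `b_j` and `b_{j+1}` of the part `B`. -/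
def identifyRight {p q : ℕ} (E : Fin p → Fin (q + 1) → Prop) (j : Fin q) :
    OrderedBipartiteGraph :=
  ⟨p, q, fun x y => ∃ y', j.predAbove y' = y ∧ E x y'⟩

/-- One operation: deleting an edge, or identifying two consecutive vertices of one part. -/
inductive Step : OrderedBipartiteGraph → OrderedBipartiteGraph → Prop
  | deleteEdge (G : OrderedBipartiteGraph) (a : Fin G.left) (b : Fin G.right) (h : G.Adj a b) :
      Step G (G.deleteEdge a b)
  | identifyLeft {p q : ℕ} (E : Fin (p + 1) → Fin q → Prop) (i : Fin p) :
      Step ⟨p + 1, q, E⟩ (OrderedBipartiteGraph.identifyLeft E i)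
  | identifyRight {p q : ℕ} (E : Fin p → Fin (q + 1) → Prop) (j : Fin q) :
      Step ⟨p, q + 1, E⟩ (OrderedBipartiteGraph.identifyRight E j)

/-- `H` is an interval minor of `G`: a graph isomorphic to `H` is obtained from `G` by repeatedly
deleting edges and identifying consecutive vertices. -/
def IsIntervalMinor (H G : OrderedBipartiteGraph) : Prop :=
  ∃ M, Relation.ReflTransGen Step G M ∧ Isomorphic M H

/-- `G` is `H`-interval minor free. -/
def IntervalMinorFree (H G : OrderedBipartiteGraph) : Prop := ¬ IsIntervalMinor H G

/-- A matching of size `n`: a 1-regular bipartite graph on `2 n` vertices. -/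
def IsMatchingOfSize (G : OrderedBipartiteGraph) (n : ℕ) : Prop :=
  G.left + G.right = 2 * n ∧ (∀ a, ∃! b, G.Adj a b) ∧ (∀ b, ∃! a, G.Adj a b)

/-- `G'` is obtained from `G` by reversing the orders in none, one or both of the parts, and
possibly exchanging the two parts. -/
def Equivalent (G G' : OrderedBipartiteGraph) : Prop :=
  ∃ H, (H = G ∨ H = G.reverseLeft ∨ H = G.reverseRight ∨ H = G.reverseLeft.reverseRight) ∧
    (G' = H ∨ G' = H.swap)

theorem swap_swap (G : OrderedBipartiteGraph) : G.swap.swap = G := rfl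

theorem swap_reverseLeft (G : OrderedBipartiteGraph) :
    G.swap.reverseLeft = G.reverseRight.swap := rfl

theorem swap_reverseRight (G : OrderedBipartiteGraph) :
    G.swap.reverseRight = G.reverseLeft.swap := rfl

theorem reverseRight_reverseLeft (G : OrderedBipartiteGraph) :
    G.reverseRight.reverseLeft = G.reverseLeft.reverseRight := rfl

theorem reverseLeft_reverseLeft (G : OrderedBipartiteGraph) :
    G.reverseLeft.reverseLeft = G := by
  simp [reverseLeft]

theorem reverseRight_reverseRight (G : OrderedBipartiteGraph) :
    G.reverseRight.reverseRight = G := by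
  simp [reverseRight]

theorem equivalent_equivalence : Equivalence Equivalent where
  refl G := ⟨G, Or.inl rfl, Or.inl rfl⟩
  symm := by
    rintro G _ ⟨_, rfl | rfl | rfl | rfl, rfl | rfl⟩ <;>
      simp [Equivalent, swap_swap, swap_reverseLeft, swap_reverseRight, reverseRight_reverseLeft,
        reverseLeft_reverseLeft, reverseRight_reverseRight]
  trans := by
    rintro G _ _ ⟨_, rfl | rfl | rfl | rfl, rfl | rfl⟩ ⟨_, rfl | rfl | rfl | rfl, rfl | rfl⟩ <;>
      simp [Equivalent, swap_swap, swap_reverseLeft, swap_reverseRight, reverseRight_reverseLeft,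
        reverseLeft_reverseLeft, reverseRight_reverseRight]

/-- Equivalence of ordered bipartite graphs, as a setoid. -/
def equivalenceSetoid : Setoid OrderedBipartiteGraph := ⟨Equivalent, equivalent_equivalence⟩

/-- The set of all `K_{2,2}`-interval minor free matchings of size `n`. -/
def freeMatchings (n : ℕ) : Set OrderedBipartiteGraph :=
  {G | G.IsMatchingOfSize n ∧ IntervalMinorFree (complete 2 2) G}

end OrderedBipartiteGraph

namespace OrderedBipartiteGraph

/-! `K_{2,2}` is an interval minor exactly when each part can be cut into an initial and a final
segment so that all four pairs of segments are joined by an edge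
(`isIntervalMinor_complete_iff_hasCut`). A matching is a permutation `σ`, and a cut is a horizontal
and a vertical line splitting its permutation matrix into four nonempty quadrants.

If there is no cut, a vertical line after the second column forces the first two values to be the
two smallest or the two largest (`first_two_of_not_hasCut`). Up to reversing `B` they are the
smallest, and then diagonal cuts force `σ k = k` away from the two ends (`exists_eq_endSwap`). Only
three binary choices remain: exchange the first two values, exchange the last two, reverse.
Conversely, these permutations have no cut (`not_hasCut_endSwap`). Equivalence preserves the number
of exchanged ends, 0, 1 or 2, and nothing else, hence three classes. -/

/-! ### Interval minors and cuts. -/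

/-- A pair of monotone two-colourings of the parts of `G` such that every pair of colours is
realised by an edge. -/
def HasCut (G : OrderedBipartiteGraph) : Prop :=
  ∃ (f : Fin G.left → Fin 2) (g : Fin G.right → Fin 2), Monotone f ∧ Monotone g ∧
    ∀ u v, ∃ a b, G.Adj a b ∧ f a = u ∧ g b = v

/-- Colourings pull back along the monotone map `predAbove`, and every edge of `M` comes from an
edge of `G`. -/
theorem HasCut.of_step {G M : OrderedBipartiteGraph} (h : Step G M) (hM : M.HasCut) :
    G.HasCut := by
  obtain ⟨f, g, hf, hg, hfg⟩ := hM
  cases h with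
  | deleteEdge a b h =>
    refine ⟨f, g, hf, hg, fun u v => ?_⟩
    obtain ⟨a, b, hab, h⟩ := hfg u v
    exact ⟨a, b, hab.1, h⟩
  | @identifyLeft p q E i =>
    refine ⟨fun x => f (i.predAbove x), g, fun x y h => hf (i.predAbove_right_monotone h), hg,
      fun u v => ?_⟩
    obtain ⟨a, b, ⟨x, rfl, hx⟩, h⟩ := hfg u v
    exact ⟨x, b, hx, h⟩
  | @identifyRight p q E j =>
    refine ⟨f, fun x => g (j.predAbove x), hf, fun x y h => hg (j.predAbove_right_monotone h),
      fun u v => ?_⟩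
    obtain ⟨a, b, ⟨x, rfl, hx⟩, h⟩ := hfg u v
    exact ⟨a, x, hx, h⟩

theorem HasCut.of_isomorphic {G : OrderedBipartiteGraph} (h : Isomorphic G (complete 2 2)) :
    G.HasCut := by
  rcases h with ⟨f, g, h⟩ | ⟨f, g, h⟩
  all_goals
    refine ⟨f, g, f.monotone, g.monotone, fun u v => ⟨f.symm u, g.symm v, ?_, ?_, ?_⟩⟩
    · exact (h _ _).2 trivial
    · exact f.apply_symm_apply u
    · exact g.apply_symm_apply v

/-- A monotone two-colouring of at least three vertices factors through the identification of two
consecutive vertices. -/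
theorem exists_predAbove_factor {p : ℕ} (hp : 2 ≤ p) {f : Fin (p + 1) → Fin 2}
    (hf : Monotone f) :
    ∃ (i : Fin p) (f' : Fin p → Fin 2), Monotone f' ∧ ∀ x, f' (i.predAbove x) = f x := by
  -- Among the first three vertices, two neighbours share a colour.
  have key : ∃ i : Fin p, f i.castSucc = f i.succ := by
    have h01 := hf (show (⟨0, by omega⟩ : Fin (p + 1)) ≤ ⟨1, by omega⟩ by simp)
    have h12 := hf (show (⟨1, by omega⟩ : Fin (p + 1)) ≤ ⟨2, by omega⟩ by simp)
    by_cases h : f ⟨0, by omega⟩ = f ⟨1, by omega⟩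
    · exact ⟨⟨0, by omega⟩, h⟩
    · exact ⟨⟨1, by omega⟩, show f ⟨1, by omega⟩ = f ⟨2, by omega⟩ by omega⟩
  obtain ⟨i, hi⟩ := key
  refine ⟨i, fun x => f (i.castSucc.succAbove x),
    fun x y h => hf (i.castSucc.strictMono_succAbove.monotone h), fun x => ?_⟩
  by_cases hx : x = i.castSucc
  · subst hx
    simp [hi]
  · exact congrArg f (Fin.succAbove_predAbove hx)

theorem fin_two_eq_self {f : Fin 2 → Fin 2} (hf : Monotone f) (hs : Function.Surjective f)
    (x : Fin 2) : f x = x := by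
  have h01 : f 0 ≤ f 1 := hf (by decide)
  obtain ⟨y, hy⟩ := hs 0
  obtain ⟨z, hz⟩ := hs 1
  fin_cases x <;> fin_cases y <;> fin_cases z <;> simp_all

theorem two_le_of_surjective {p : ℕ} {f : Fin p → Fin 2} (hs : Function.Surjective f) : 2 ≤ p := by
  simpa using Fintype.card_le_of_surjective f hs

/-- Induction on the number of vertices: a part with more than two vertices has two consecutive ones
of the same colour, and identifying them keeps the cut. Once both parts have two vertices, the
colourings are identities and the graph is complete. -/
theorem HasCut.isIntervalMinor {G : OrderedBipartiteGraph} (hG : G.HasCut) :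
    IsIntervalMinor (complete 2 2) G := by
  induction h : G.left + G.right using Nat.strong_induction_on generalizing G with
  | _ N ih =>
    obtain ⟨p, q, E⟩ := G
    obtain ⟨f, g, hf, hg, hfg⟩ := hG
    dsimp only at f g hf hg hfg h
    have hfs : Function.Surjective f := fun u => by
      obtain ⟨a, b, -, h, -⟩ := hfg u 0
      exact ⟨a, h⟩
    have hgs : Function.Surjective g := fun v => by
      obtain ⟨a, b, -, -, h⟩ := hfg 0 v
      exact ⟨b, h⟩
    have hp := two_le_of_surjective hfs
    have hq := two_le_of_surjective hgs
    obtain rfl | hp := hp.eq_or_lt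
    · obtain rfl | hq := hq.eq_or_lt
      · refine ⟨_, .refl, Or.inl ⟨OrderIso.refl _, OrderIso.refl _, fun a b =>
          iff_of_true ?_ trivial⟩⟩
        obtain ⟨a', b', hab, rfl, rfl⟩ := hfg a b
        simpa only [fin_two_eq_self hf hfs, fin_two_eq_self hg hgs] using hab
      · obtain ⟨q, rfl⟩ : ∃ k, q = k + 1 := ⟨q - 1, by omega⟩
        obtain ⟨j, g', hg', hj⟩ := exists_predAbove_factor (by omega) hg
        obtain ⟨M, hM, hiso⟩ := ih (2 + q) (by omega) (G := identifyRight E j)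
          ⟨f, g', hf, hg', fun u v => by
            obtain ⟨a, b, hab, ha, hb⟩ := hfg u v
            exact ⟨a, j.predAbove b, ⟨b, rfl, hab⟩, ha, (hj b).trans hb⟩⟩ rfl
        exact ⟨M, .head (.identifyRight E j) hM, hiso⟩
    · obtain ⟨p, rfl⟩ : ∃ k, p = k + 1 := ⟨p - 1, by omega⟩
      obtain ⟨i, f', hf', hi⟩ := exists_predAbove_factor (by omega) hf
      obtain ⟨M, hM, hiso⟩ := ih (p + q) (by omega) (G := identifyLeft E i)
        ⟨f', g, hf', hg, fun u v => by
          obtain ⟨a, b, hab, ha, hb⟩ := hfg u v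
          exact ⟨i.predAbove a, b, ⟨a, rfl, hab⟩, (hi a).trans ha, hb⟩⟩ rfl
      exact ⟨M, .head (.identifyLeft E i) hM, hiso⟩

theorem isIntervalMinor_complete_iff_hasCut {G : OrderedBipartiteGraph} :
    IsIntervalMinor (complete 2 2) G ↔ G.HasCut := by
  refine ⟨?_, HasCut.isIntervalMinor⟩
  rintro ⟨M, hM, hiso⟩
  induction hM using Relation.ReflTransGen.head_induction_on with
  | refl => exact .of_isomorphic hiso
  | head h _ ih => exact ih.of_step h

theorem HasCut.reverseRight {G : OrderedBipartiteGraph} (hG : G.HasCut) :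
    G.reverseRight.HasCut := by
  obtain ⟨f, g, hf, hg, hfg⟩ := hG
  refine ⟨f, fun b => (g b.rev).rev, hf, fun x y h => Fin.rev_le_rev.2 (hg (Fin.rev_le_rev.2 h)),
    fun u v => ?_⟩
  obtain ⟨a, b, hab, ha, hb⟩ := hfg u v.rev
  refine ⟨a, b.rev, ?_, ha, ?_⟩
  · change G.Adj a b.rev.rev
    rwa [Fin.rev_rev]
  · change (g b.rev.rev).rev = v
    rw [Fin.rev_rev, hb, Fin.rev_rev]

theorem hasCut_reverseRight {G : OrderedBipartiteGraph} : G.reverseRight.HasCut ↔ G.HasCut :=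
  ⟨fun h => by simpa only [reverseRight_reverseRight] using h.reverseRight, HasCut.reverseRight⟩

/-! ### Matchings as permutations. -/

/-- The matching with edges `a_i b_{σ i}`. -/
def ofPerm {n : ℕ} (σ : Equiv.Perm (Fin n)) : OrderedBipartiteGraph := ⟨n, n, fun a b => σ a = b⟩

theorem ofPerm_injective {n : ℕ} : Function.Injective (ofPerm (n := n)) := by
  intro σ τ h
  simp only [ofPerm, OrderedBipartiteGraph.mk.injEq, heq_eq_eq, true_and] at h
  ext a
  rw [show τ a = σ a from (congrFun (congrFun h a) (σ a)).mp rfl]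

theorem isMatchingOfSize_iff {G : OrderedBipartiteGraph} {n : ℕ} :
    G.IsMatchingOfSize n ↔ ∃ σ : Equiv.Perm (Fin n), G = ofPerm σ := by
  constructor
  · obtain ⟨p, q, E⟩ := G
    rintro ⟨hpq, hl, hr⟩
    dsimp only at hpq hl hr
    choose φ hφ hφ' using hl
    have hbij : Function.Bijective φ := by
      constructor
      · intro a a' h
        exact (hr (φ a)).unique (hφ a) (h ▸ hφ a')
      · intro b
        obtain ⟨a, ha, -⟩ := hr b
        exact ⟨a, (hφ' a b ha).symm⟩
    have hcard : p = q := by simpa using Fintype.card_of_bijective hbij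
    obtain rfl : p = n := by omega
    subst hcard
    refine ⟨Equiv.ofBijective φ hbij, ?_⟩
    simp only [ofPerm, OrderedBipartiteGraph.mk.injEq, heq_eq_eq, true_and]
    funext a b
    exact propext ⟨fun h => (hφ' a b h).symm, fun h => h ▸ hφ a⟩
  · rintro ⟨σ, rfl⟩
    exact ⟨(two_mul n).symm, fun a => ⟨σ a, rfl, fun b hb => Eq.symm hb⟩,
      fun b => ⟨σ.symm b, σ.apply_symm_apply b, fun a ha => (σ.symm_apply_eq.2 (Eq.symm ha)).symm⟩⟩

theorem ofPerm_reverseRight {n : ℕ} (σ : Equiv.Perm (Fin n)) :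
    (ofPerm σ).reverseRight = ofPerm (σ.trans Fin.revPerm) := by
  simp only [ofPerm, reverseRight, OrderedBipartiteGraph.mk.injEq, heq_eq_eq, true_and]
  funext a b
  exact propext Fin.rev_eq_iff.symm

theorem ofPerm_reverseLeft {n : ℕ} (σ : Equiv.Perm (Fin n)) :
    (ofPerm σ).reverseLeft = ofPerm (Fin.revPerm.trans σ) := rfl

theorem ofPerm_swap {n : ℕ} (σ : Equiv.Perm (Fin n)) : (ofPerm σ).swap = ofPerm σ.symm := by
  simp only [ofPerm, swap, OrderedBipartiteGraph.mk.injEq, heq_eq_eq, true_and]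
  funext a b
  exact propext ⟨fun h => σ.symm_apply_eq.2 (Eq.symm h), fun h => Eq.symm (σ.symm_apply_eq.1 h)⟩

theorem hasCut_ofPerm_of_lt {n : ℕ} (σ : Equiv.Perm (Fin n)) (i j : ℕ)
    (h₀₀ : ∃ a : Fin n, (a : ℕ) < i ∧ (σ a : ℕ) < j)
    (h₀₁ : ∃ a : Fin n, (a : ℕ) < i ∧ j ≤ (σ a : ℕ))
    (h₁₀ : ∃ a : Fin n, i ≤ (a : ℕ) ∧ (σ a : ℕ) < j)
    (h₁₁ : ∃ a : Fin n, i ≤ (a : ℕ) ∧ j ≤ (σ a : ℕ)) :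
    (ofPerm σ).HasCut := by
  have mono (k : ℕ) : Monotone fun x : Fin n => if (x : ℕ) < k then (0 : Fin 2) else 1 := by
    intro x y h
    have h' : (x : ℕ) ≤ y := h
    dsimp only
    split_ifs <;> omega
  refine ⟨fun x => if (x : ℕ) < i then 0 else 1, fun y => if (y : ℕ) < j then 0 else 1,
    mono i, mono j, fun u v => ?_⟩
  have hu : u = 0 ∨ u = 1 := by omega
  have hv : v = 0 ∨ v = 1 := by omega
  obtain ⟨a, ha, hb⟩ : ∃ a : Fin n, (if (a : ℕ) < i then (0 : Fin 2) else 1) = u ∧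
      (if (σ a : ℕ) < j then (0 : Fin 2) else 1) = v := by
    rcases hu with rfl | rfl <;> rcases hv with rfl | rfl <;> simpa
  exact ⟨a, σ a, rfl, ha, hb⟩

/-! ### The eight matchings and their symmetries. -/

/-- The identity of `{0, ..., n - 1}`, with the first two values exchanged if `s` holds and the last
two values exchanged if `t` holds. -/
def endSwapVal (n : ℕ) (s t : Bool) (k : ℕ) : ℕ :=
  -- The map `k ↦ 2 * n - 3 - k` exchanges `n - 2` and `n - 1`; for `4 ≤ n` the two ends are
  -- disjoint.
  if s ∧ k ≤ 1 then 1 - k else if t ∧ n ≤ k + 2 then 2 * n - 3 - k else k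

variable {n : ℕ}

theorem endSwapVal_lt (hn : 4 ≤ n) (s t : Bool) {k : ℕ} (hk : k < n) : endSwapVal n s t k < n := by
  unfold endSwapVal
  split_ifs <;> omega

theorem endSwapVal_endSwapVal (hn : 4 ≤ n) (s t : Bool) {k : ℕ} (hk : k < n) :
    endSwapVal n s t (endSwapVal n s t k) = k := by
  unfold endSwapVal
  cases s <;> cases t <;> simp <;> split_ifs <;> omega

theorem endSwapVal_rev (hn : 4 ≤ n) (s t : Bool) {k : ℕ} (hk : k < n) :
    endSwapVal n s t (n - (k + 1)) = n - (endSwapVal n t s k + 1) := by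
  unfold endSwapVal
  cases s <;> cases t <;> simp <;> split_ifs <;> omega

theorem endSwapVal_inversion (hn : 4 ≤ n) (s t : Bool) {k l : ℕ} (hkl : k < l) (hl : l < n)
    (h : endSwapVal n s t l < endSwapVal n s t k) : l = 1 ∨ k + 2 = n := by
  unfold endSwapVal at h
  cases s <;> cases t <;> simp at h <;> (try split_ifs at h) <;> omega

theorem endSwapVal_zero (hn : 4 ≤ n) (s t : Bool) : endSwapVal n s t 0 = s.toNat := by
  unfold endSwapVal
  cases s <;> simp
  omega

theorem endSwapVal_last (hn : 4 ≤ n) (s t : Bool) :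
    endSwapVal n s t (n - 1) = n - 1 - t.toNat := by
  unfold endSwapVal
  cases s <;> cases t <;> simp <;> (try split_ifs) <;> omega

/-- `endSwapVal` as a permutation. -/
def endSwap (hn : 4 ≤ n) (s t : Bool) : Equiv.Perm (Fin n) :=
  Function.Involutive.toPerm (fun a => ⟨endSwapVal n s t a, endSwapVal_lt hn s t a.2⟩)
    fun a => Fin.ext (endSwapVal_endSwapVal hn s t a.2)

theorem endSwap_val (hn : 4 ≤ n) (s t : Bool) (a : Fin n) :
    (endSwap hn s t a : ℕ) = endSwapVal n s t a := rfl

theorem endSwap_symm (hn : 4 ≤ n) (s t : Bool) : (endSwap hn s t).symm = endSwap hn s t := rfl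

theorem endSwap_rev (hn : 4 ≤ n) (s t : Bool) :
    Fin.revPerm.trans (endSwap hn s t) = (endSwap hn t s).trans Fin.revPerm := by
  ext a
  simp only [Equiv.trans_apply, Fin.revPerm_apply, endSwap_val, Fin.val_rev]
  exact endSwapVal_rev hn s t a.2

/-- The identity matching modified at its ends by `s` and `t`, reversed if `r` holds. -/
def freeMatching (hn : 4 ≤ n) : Bool × Bool × Bool → OrderedBipartiteGraph
  | (s, t, false) => ofPerm (endSwap hn s t)
  | (s, t, true) => (ofPerm (endSwap hn s t)).reverseRight

theorem freeMatching_reverseRight (hn : 4 ≤ n) (s t r : Bool) :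
    (freeMatching hn (s, t, r)).reverseRight = freeMatching hn (s, t, !r) := by
  cases r
  · rfl
  · exact reverseRight_reverseRight _

theorem freeMatching_reverseLeft (hn : 4 ≤ n) (s t r : Bool) :
    (freeMatching hn (s, t, r)).reverseLeft = freeMatching hn (t, s, !r) := by
  have key (s t : Bool) :
      (ofPerm (endSwap hn s t)).reverseLeft = (ofPerm (endSwap hn t s)).reverseRight := by
    rw [ofPerm_reverseLeft, ofPerm_reverseRight, endSwap_rev]
  cases r
  · exact key s t
  · change (ofPerm (endSwap hn s t)).reverseRight.reverseLeft = ofPerm (endSwap hn t s)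
    rw [reverseRight_reverseLeft, key, reverseRight_reverseRight]

/-- `endSwap` is an involution, so exchanging the parts fixes its matching. In the reversed case the
exchange turns a reversal of `B` into one of `A`, which interchanges the roles of the ends. -/
theorem freeMatching_swap (hn : 4 ≤ n) (s t r : Bool) :
    (freeMatching hn (s, t, r)).swap =
      freeMatching hn (if r then (t, s, true) else (s, t, false)) := by
  cases r
  · exact ofPerm_swap _
  · change (ofPerm (endSwap hn s t)).swap.reverseLeft = (ofPerm (endSwap hn t s)).reverseRight
    rw [ofPerm_swap, endSwap_symm]
    exact freeMatching_reverseLeft hn s t false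

/-- The values at `0` and `n - 1` determine everything: which extreme they lie near gives `r`, and
their distance from it gives `s` and `t`. -/
theorem freeMatching_injective (hn : 4 ≤ n) : Function.Injective (freeMatching hn) := by
  have heq (p : Bool × Bool × Bool) : freeMatching hn p = ofPerm
      ((endSwap hn p.1 p.2.1).trans (if p.2.2 then Fin.revPerm else Equiv.refl _)) := by
    obtain ⟨s, t, _ | _⟩ := p
    · rfl
    · exact ofPerm_reverseRight _
  rintro ⟨s, t, r⟩ ⟨s', t', r'⟩ h
  rw [heq, heq] at h
  have h' := ofPerm_injective h
  have h0 := congrArg Fin.val (DFunLike.congr_fun h' ⟨0, by omega⟩)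
  have h1 := congrArg Fin.val (DFunLike.congr_fun h' ⟨n - 1, by omega⟩)
  clear heq h h'
  cases r <;> cases r' <;>
    simp [endSwap_val, Fin.val_rev, endSwapVal_zero hn, endSwapVal_last hn] at h0 h1 ⊢ <;>
    cases s <;> cases s' <;> cases t <;> cases t' <;> simp at h0 h1 ⊢ <;> omega

/-! ### Classification of the free matchings. -/

/-- The off-diagonal quadrants give an inversion `x < y`, which must sit at an end. At the lower end
only position `0` precedes `y`, so `w = x`; at the upper end only `n - 1` follows `x`, so `z = y`.
Either way two different quadrants share a point. -/
theorem not_hasCut_endSwap (hn : 4 ≤ n) (s t : Bool) : ¬ (ofPerm (endSwap hn s t)).HasCut := by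
  rintro ⟨f, g, hf, hg, hfg⟩
  obtain ⟨w, _, rfl, hw, hw'⟩ := hfg 0 0
  obtain ⟨x, _, rfl, hx, hx'⟩ := hfg 0 1
  obtain ⟨y, _, rfl, hy, hy'⟩ := hfg 1 0
  obtain ⟨z, _, rfl, hz, hz'⟩ := hfg 1 1
  have lt_of_f {a b : Fin n} (ha : f a = 0) (hb : f b = 1) : (a : ℕ) < b := by
    by_contra h
    have := hf (show b ≤ a from not_lt.1 h)
    simp [ha, hb] at this
  have lt_of_g {a b : Fin n} (ha : g a = 0) (hb : g b = 1) : (a : ℕ) < b := by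
    by_contra h
    have := hg (show b ≤ a from not_lt.1 h)
    simp [ha, hb] at this
  have hwy := lt_of_f hw hy
  have hxz := lt_of_f hx hz
  have hxy := lt_of_f hx hy
  rcases endSwapVal_inversion hn s t hxy y.2 (lt_of_g hy' hx') with h | h
  · obtain rfl : w = x := by omega
    simp [hw'] at hx'
  · obtain rfl : z = y := by omega
    simp [hz'] at hy'

theorem exists_eq_endSwap (hn : 4 ≤ n) (σ : Equiv.Perm (Fin n)) (hσ : ¬ (ofPerm σ).HasCut)
    (h₀ : (σ ⟨0, by omega⟩ : ℕ) ≤ 1) (h₁ : (σ ⟨1, by omega⟩ : ℕ) ≤ 1) :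
    ∃ s t, σ = endSwap hn s t := by
  have inj (a b : Fin n) (h : (σ a : ℕ) = σ b) : (a : ℕ) = b :=
    congrArg Fin.val (σ.injective (Fin.ext h))
  have low (k : ℕ) (hk : k ≤ 1) : ∃ x : Fin n, (x : ℕ) ≤ 1 ∧ (σ x : ℕ) = k := by
    have := inj ⟨0, by omega⟩ ⟨1, by omega⟩
    by_cases h : (σ ⟨0, by omega⟩ : ℕ) = k
    · exact ⟨_, by simp, h⟩
    · exact ⟨⟨1, by omega⟩, le_rfl, by simp at this; omega⟩
  -- If all smaller positions are settled and `σ k ≠ k`, then both `σ k` and the preimage `y` of `k`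
  -- exceed `k`, and cutting both parts after `k` fills all four quadrants.
  have mid (k : ℕ) (h2 : 2 ≤ k) (hk : k + 2 < n) : (σ ⟨k, by omega⟩ : ℕ) = k := by
    induction k using Nat.strong_induction_on with
    | _ k ih =>
      by_contra hne
      have ge (a : Fin n) (ha : k ≤ a) : k ≤ σ a := by
        by_contra hlt
        push Not at hlt
        by_cases h : (σ a : ℕ) ≤ 1
        · obtain ⟨x, hx, hx'⟩ := low _ h
          have := inj _ _ hx'
          omega
        · have h3 := ih (σ a) hlt (by omega) (by omega)
          have := inj _ _ h3
          simp at this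
          omega
      have hgt := ge ⟨k, by omega⟩ le_rfl
      obtain ⟨y, hy⟩ := σ.surjective ⟨k, by omega⟩
      have hy' : (σ y : ℕ) = k := by rw [hy]
      have hyk : k + 1 ≤ (y : ℕ) := by
        by_contra hlt
        by_cases h1 : (y : ℕ) ≤ 1
        · have : (y : ℕ) = 0 ∨ (y : ℕ) = 1 := by omega
          rcases this with h | h
          · rw [show y = ⟨0, by omega⟩ from Fin.ext h] at hy'
            omega
          · rw [show y = ⟨1, by omega⟩ from Fin.ext h] at hy'
            omega
        · by_cases hyk : (y : ℕ) = k
          · rw [show y = ⟨k, by omega⟩ from Fin.ext hyk] at hy'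
            omega
          · have := ih y (by omega) (by omega) (by omega)
            rw [Fin.eta] at this
            omega
      have big (z : Fin n) (hz : k + 1 ≤ (z : ℕ)) (hzy : (z : ℕ) ≠ y) : k + 1 ≤ (σ z : ℕ) := by
        have h1 := ge z (by omega)
        have h2 := inj z y
        omega
      refine hσ (hasCut_ofPerm_of_lt σ (k + 1) (k + 1) ⟨⟨0, by omega⟩, by simp, by omega⟩
        ⟨⟨k, by omega⟩, by simp, by omega⟩ ⟨y, hyk, by omega⟩ ?_)
      -- The last quadrant needs a position beyond `k` other than `y`; since `k + 2 < n`, one of `n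
      -- - 1` and `n - 2` serves.
      by_cases h : (y : ℕ) = n - 1
      · exact ⟨⟨n - 2, by omega⟩, by simp; omega, big _ (by simp; omega) (by simp; omega)⟩
      · exact ⟨⟨n - 1, by omega⟩, by simp; omega, big _ (by simp; omega) (by simp; omega)⟩
  -- All values below `n - 2` are already taken at positions below `n - 2`.
  have high (a : Fin n) (ha : n ≤ (a : ℕ) + 2) : n ≤ (σ a : ℕ) + 2 := by
    by_contra hlt
    by_cases h : (σ a : ℕ) ≤ 1
    · obtain ⟨x, hx, hx'⟩ := low _ h
      have := inj _ _ hx'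
      omega
    · have := inj _ _ (mid (σ a) (by omega) (by omega))
      simp at this
      omega
  refine ⟨decide ((σ ⟨0, by omega⟩ : ℕ) = 1), decide ((σ ⟨n - 1, by omega⟩ : ℕ) + 2 = n), ?_⟩
  ext a
  rw [endSwap_val]
  have i01 := inj ⟨0, by omega⟩ ⟨1, by omega⟩
  have ilast := inj ⟨n - 2, by omega⟩ ⟨n - 1, by omega⟩
  simp only at i01 ilast
  have hl1 := high ⟨n - 1, by omega⟩ (by simp; omega)
  have hl2 := high ⟨n - 2, by omega⟩ (by simp; omega)
  have b1 := (σ ⟨n - 1, by omega⟩).2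
  have b2 := (σ ⟨n - 2, by omega⟩).2
  have ha := a.2
  unfold endSwapVal
  simp only [decide_eq_true_eq]
  by_cases c0 : (a : ℕ) = 0
  · rw [show a = ⟨0, by omega⟩ from Fin.ext c0]
    simp only
    split_ifs <;> omega
  by_cases c1 : (a : ℕ) = 1
  · rw [show a = ⟨1, by omega⟩ from Fin.ext c1]
    simp only
    split_ifs <;> omega
  by_cases c2 : (a : ℕ) = n - 1
  · rw [show a = ⟨n - 1, by omega⟩ from Fin.ext c2]
    simp only
    split_ifs <;> omega
  by_cases c3 : (a : ℕ) = n - 2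
  · rw [show a = ⟨n - 2, by omega⟩ from Fin.ext c3]
    simp only
    split_ifs <;> omega
  have := mid a (by omega) (by omega)
  rw [Fin.eta] at this
  split_ifs <;> omega

theorem first_two_of_not_hasCut (hn : 4 ≤ n) (σ : Equiv.Perm (Fin n))
    (hσ : ¬ (ofPerm σ).HasCut) :
    ((σ ⟨0, by omega⟩ : ℕ) ≤ 1 ∧ (σ ⟨1, by omega⟩ : ℕ) ≤ 1) ∨
      (n ≤ (σ ⟨0, by omega⟩ : ℕ) + 2 ∧ n ≤ (σ ⟨1, by omega⟩ : ℕ) + 2) := by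
  have key (x y : Fin n) (hx : (x : ℕ) < 2) (hy : (y : ℕ) < 2) (hxy : (σ x : ℕ) < σ y) :
      (σ y : ℕ) ≤ 1 ∨ n ≤ (σ x : ℕ) + 2 := by
    by_contra! h
    have other (c : Fin n) (h1 : (c : ℕ) ≠ σ x) (h2 : (c : ℕ) ≠ σ y) :
        ∃ a : Fin n, 2 ≤ (a : ℕ) ∧ σ a = c := by
      obtain ⟨a, rfl⟩ := σ.surjective c
      refine ⟨a, ?_, rfl⟩
      by_contra hlt
      have hax : (a : ℕ) ≠ x := fun h => h1 (by rw [Fin.ext h])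
      have hay : (a : ℕ) ≠ y := fun h => h2 (by rw [Fin.ext h])
      have hne : (x : ℕ) ≠ y := fun h => hxy.ne (by rw [Fin.ext h])
      omega
    -- This threshold separates `σ x` from `σ y` and leaves at least two values on each side,
    -- because `2 ≤ σ y` and `σ x ≤ n - 3`. So each side has a value other than `σ x` and `σ y`,
    -- attained at a position `≥ 2`.
    refine hσ (hasCut_ofPerm_of_lt σ 2 (max 2 (σ x + 1)) ⟨x, hx, by omega⟩
      ⟨y, hy, by omega⟩ ?_ ?_)
    · by_cases hc : (σ x : ℕ) = 0
      · obtain ⟨a, ha, h⟩ := other ⟨1, by omega⟩ (by simp; omega) (by simp; omega)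
        exact ⟨a, ha, by simp [h]⟩
      · obtain ⟨a, ha, h⟩ := other ⟨0, by omega⟩ (by simp; omega) (by simp; omega)
        exact ⟨a, ha, by simp [h]⟩
    · by_cases hc : (σ y : ℕ) = n - 1
      · obtain ⟨a, ha, h⟩ := other ⟨n - 2, by omega⟩ (by simp; omega) (by simp; omega)
        exact ⟨a, ha, by rw [h]; simp only; omega⟩
      · obtain ⟨a, ha, h⟩ := other ⟨n - 1, by omega⟩ (by simp; omega) (by simp; omega)
        exact ⟨a, ha, by rw [h]; simp only; omega⟩
  have hne : (σ ⟨0, by omega⟩ : ℕ) ≠ σ ⟨1, by omega⟩ := fun h => by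
    simpa using σ.injective (Fin.ext h)
  rcases hne.lt_or_gt with h | h
  · have := key _ _ (by simp) (by simp) h
    omega
  · have := key _ _ (by simp) (by simp) h
    omega

theorem freeMatchings_eq_range (hn : 4 ≤ n) :
    freeMatchings n = Set.range (freeMatching hn) := by
  ext G
  simp only [freeMatchings, Set.mem_ofPred_eq, IntervalMinorFree,
    isIntervalMinor_complete_iff_hasCut, isMatchingOfSize_iff, Set.mem_range]
  constructor
  · rintro ⟨⟨σ, rfl⟩, hσ⟩
    rcases first_two_of_not_hasCut hn σ hσ with ⟨h₀, h₁⟩ | ⟨h₀, h₁⟩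
    · obtain ⟨s, t, rfl⟩ := exists_eq_endSwap hn σ hσ h₀ h₁
      exact ⟨(s, t, false), rfl⟩
    -- Reversing `B` turns the two largest values into the two smallest.
    · rw [← hasCut_reverseRight, ofPerm_reverseRight] at hσ
      obtain ⟨s, t, h⟩ := exists_eq_endSwap hn _ hσ
        (by simp [Fin.val_rev]; omega) (by simp [Fin.val_rev]; omega)
      refine ⟨(s, t, true), ?_⟩
      change (ofPerm (endSwap hn s t)).reverseRight = _
      rw [← h, ← ofPerm_reverseRight, reverseRight_reverseRight]
  · rintro ⟨⟨s, t, _ | _⟩, rfl⟩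
    · exact ⟨⟨_, rfl⟩, not_hasCut_endSwap hn s t⟩
    · exact ⟨⟨_, ofPerm_reverseRight _⟩, fun h =>
        not_hasCut_endSwap hn s t (hasCut_reverseRight.1 h)⟩

/-! ### The three equivalence classes. -/

/-- The graphs equivalent to one of the eight matchings are among them, with as many exchanged
ends. -/
theorem exists_of_equivalent_freeMatching (hn : 4 ≤ n) {s t r : Bool} {G : OrderedBipartiteGraph}
    (h : (freeMatching hn (s, t, r)).Equivalent G) :
    ∃ s' t' r', G = freeMatching hn (s', t', r') ∧
      s'.toNat + t'.toNat = s.toNat + t.toNat := by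
  obtain ⟨H, hH, hG⟩ := h
  obtain ⟨s₁, t₁, r₁, rfl, h₁⟩ : ∃ s' t' r', H = freeMatching hn (s', t', r') ∧
      s'.toNat + t'.toNat = s.toNat + t.toNat := by
    rcases hH with rfl | rfl | rfl | rfl
    · exact ⟨s, t, r, rfl, rfl⟩
    · exact ⟨_, _, _, freeMatching_reverseLeft hn s t r, add_comm _ _⟩
    · exact ⟨_, _, _, freeMatching_reverseRight hn s t r, rfl⟩
    · rw [freeMatching_reverseLeft]
      exact ⟨_, _, _, freeMatching_reverseRight hn _ _ _, add_comm _ _⟩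
  rcases hG with rfl | rfl
  · exact ⟨_, _, _, rfl, h₁⟩
  · rw [freeMatching_swap]
    cases r₁
    · exact ⟨_, _, _, rfl, h₁⟩
    · exact ⟨_, _, _, rfl, (add_comm _ _).trans h₁⟩

/-- The number of exchanged ends is a complete invariant: reversing `B` toggles `r` alone, and
reversing `A` toggles `r` while interchanging `s` and `t`. -/
theorem freeMatching_equivalent_iff (hn : 4 ≤ n) (s t r s' t' r' : Bool) :
    (freeMatching hn (s, t, r)).Equivalent (freeMatching hn (s', t', r')) ↔
      s.toNat + t.toNat = s'.toNat + t'.toNat := by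
  constructor
  · intro h
    obtain ⟨s₁, t₁, r₁, h, h₁⟩ := exists_of_equivalent_freeMatching hn h
    have h' := freeMatching_injective hn h
    simp only [Prod.mk.injEq] at h'
    obtain ⟨rfl, rfl, rfl⟩ := h'
    exact h₁.symm
  · intro h
    have h' : (s = s' ∧ t = t') ∨ (s = t' ∧ t = s') := by
      revert h
      revert s t s' t'
      decide
    rcases h' with ⟨rfl, rfl⟩ | ⟨rfl, rfl⟩
    · refine ⟨freeMatching hn (s, t, r'), ?_, Or.inl rfl⟩
      rw [freeMatching_reverseRight]
      cases r <;> cases r' <;> simp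
    · refine ⟨freeMatching hn (t, s, r'), ?_, Or.inl rfl⟩
      rw [freeMatching_reverseLeft, freeMatching_reverseRight, freeMatching_reverseRight]
      cases r <;> cases r' <;> simp

theorem ncard_quotient_image_freeMatchings (hn : 4 ≤ n) :
    ((Quotient.mk equivalenceSetoid) '' freeMatchings n).ncard = 3 := by
  have mk_eq (s t r s' t' r' : Bool) :
      Quotient.mk equivalenceSetoid (freeMatching hn (s, t, r)) =
        Quotient.mk equivalenceSetoid (freeMatching hn (s', t', r')) ↔
      s.toNat + t.toNat = s'.toNat + t'.toNat :=
    Quotient.eq.trans (freeMatching_equivalent_iff hn s t r s' t' r')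
  rw [Set.ncard_eq_three]
  refine ⟨Quotient.mk _ (freeMatching hn (false, false, false)),
    Quotient.mk _ (freeMatching hn (true, false, false)),
    Quotient.mk _ (freeMatching hn (true, true, false)), ?_, ?_, ?_, ?_⟩
  · simp [mk_eq]
  · simp [mk_eq]
  · simp [mk_eq]
  · rw [freeMatchings_eq_range hn, ← Set.range_comp]
    ext c
    simp only [Set.mem_range, Function.comp_apply, Set.mem_insert_iff, Set.mem_singleton_iff]
    constructor
    · rintro ⟨⟨s, t, r⟩, rfl⟩
      simp only [mk_eq]
      cases s <;> cases t <;> simp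
    · rintro (rfl | rfl | rfl) <;> exact ⟨_, rfl⟩

end OrderedBipartiteGraph

theorem mainTheorem6 (n : ℕ) (hn : 4 ≤ n) :
    (OrderedBipartiteGraph.freeMatchings n).ncard = 8 ∧
      ((Quotient.mk OrderedBipartiteGraph.equivalenceSetoid) ''
        OrderedBipartiteGraph.freeMatchings n).ncard = 3 ∧
      (∀ G ∈ OrderedBipartiteGraph.freeMatchings n, ∀ G' : OrderedBipartiteGraph,
        G.Equivalent G' → G' ∈ OrderedBipartiteGraph.freeMatchings n) := by
  refine ⟨?_, OrderedBipartiteGraph.ncard_quotient_image_freeMatchings hn, ?_⟩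
  · rw [OrderedBipartiteGraph.freeMatchings_eq_range hn, ← Set.image_univ,
      Set.ncard_image_of_injective _ (OrderedBipartiteGraph.freeMatching_injective hn),
      Set.ncard_univ]
    simp
  · rw [OrderedBipartiteGraph.freeMatchings_eq_range hn]
    rintro _ ⟨⟨s, t, r⟩, rfl⟩ G' h
    obtain ⟨s', t', r', rfl, -⟩ :=
      OrderedBipartiteGraph.exists_of_equivalent_freeMatching hn h
    exact ⟨_, rfl⟩
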